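/- There is a universal constant $C>0$ such that the following holds. Let $L\ge 0$, $T\ge 0$, $d_y,d_u\ge 0$ be integers, let $\Sigma\in\mathbb R^{d_y\times d_y}$ be symmetric positive semidefinite, and let $\eta(0),\dots,\eta(T-1)\sim N(0,\Sigma)$ be i.i.d. random vectors in $\mathbb R^{d_y}$. Let $M_\eta\in\mathbb R^{T\times d_y}$ be the matrix with rows $\eta(0)^\top,\dots,\eta(T-1)^\top$. Let $\Phi\in\mathbb R^{(L+1)d_u\times T}$ be a fixed (deterministic) matrix, and let $E(0),\dots,E(L)\in\mathbb R^{d_y\times d_u}$ be the random matrices such that, almost surely, $$M_E:=\begin{pmatrix}E(0)^\top\\ \vdots\\ E(L)^\top\end{pmatrix}=\Phi M_\eta\in\mathbb R^{(L+1)d_u\times d_y}.$$ Then for every $0<\delta\le \tfrac12$ and every window $\{a+1,\dots,a+L'\}\subseteq\{0,\dots,L\}$ of length $L'\ge 1$ (that is, $a$ is an integer with $-1\le a\le L-L'$), $$\mathbb P\Big(\big\|E\,\mathbf 1_{[a+1,a+L']}\big\|_{\mathcal H_\infty}\le C\sqrt{L'}\,\|\Sigma\|^{1/2}\,\|\Phi\|\,\sqrt{d_y+d_u+\log(L'/\delta)}\Big)\ge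 1-\delta .$$ Here $\|\cdot\|$ is the operator norm of a matrix with respect to Euclidean norms, $E\,\mathbf 1_{[a+1,a+L']}$ is the sequence that equals $E(t)$ for $a+1\le t\le a+L'$ and $0$ for all other $t\ge 0$, and for a matrix-valued sequence $F$ on $\mathbb N_0=\{0,1,2,\dots\}$ one writes $\|F\|_{\mathcal H_\infty}=\sup_{z\in\mathbb C,\,|z|=1}\big\|\sum_{n\ge 0}F(n)z^{-n}\big\|$. -/

import Mathlib

open MeasureTheory ProbabilityTheory
open scoped ENNReal Matrix Matrix.Norms.L2Operator

/- The norm `‖A‖` of a real or complex matrix is, throughout, the operator norm induced by the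
Euclidean norms on vectors (the scope `Matrix.Norms.L2Operator`). -/

namespace ImpulseResponse

/-- The matrix `M_F` obtained by stacking `F(0)ᵀ, …, F(L)ᵀ` vertically: the `t`-th block of rows
is `F(t)ᵀ`, so that the entry in row `(t, j)` and column `i` is `F(t) i j`. -/
def stackMatrices {dy du : ℕ} (L : ℕ) (F : ℕ → Matrix (Fin dy) (Fin du) ℝ) :
    Matrix (Fin (L + 1) × Fin du) (Fin dy) ℝ :=
  Matrix.of fun p i => (F p.1)ᵀ p.2 i

/-- The `T × d` matrix `M_v` whose rows are `v(0)ᵀ, …, v(T-1)ᵀ`. -/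
def stackVectors {T d : ℕ} (v : Fin T → EuclideanSpace ℝ (Fin d)) :
    Matrix (Fin T) (Fin d) ℝ :=
  Matrix.of fun t i => v t i

/-- The restriction `F · 1_[a+1, a+ℓ]` of `F` to a window of length `ℓ`, extended by zero. -/
noncomputable def restrictWindow {dy du : ℕ} (a : ℤ) (ℓ : ℕ)
    (F : ℕ → Matrix (Fin dy) (Fin du) ℝ) : ℕ → Matrix (Fin dy) (Fin du) ℝ :=
  Set.indicator {k : ℕ | (k : ℤ) ∈ Set.Icc (a + 1) (a + ℓ)} F

/-- The Z-transform `z ↦ ∑ₙ F(n) z⁻ⁿ` on the unit circle. -/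
noncomputable def zTransform {dy du : ℕ} (F : ℕ → Matrix (Fin dy) (Fin du) ℝ) (z : Circle) :
    Matrix (Fin dy) (Fin du) ℂ :=
  ∑' n : ℕ, ((z : ℂ)⁻¹ ^ n) • (F n).map (fun x : ℝ => (x : ℂ))

/-- The `H∞` norm `sup_{|z| = 1} ‖Z[F](z)‖` of a matrix-valued sequence, with values in
`[0, ∞]`, so that no boundedness is presupposed. -/
noncomputable def hInftyNorm {dy du : ℕ} (F : ℕ → Matrix (Fin dy) (Fin du) ℝ) : ℝ≥0∞ :=
  ⨆ z : Circle, ENNReal.ofReal ‖zTransform F z‖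

end ImpulseResponse

/-! The supremum over the circle is reduced to finitely many deterministic real combinations `∑ cᵢ
E(i)`, each of which has Gaussian bilinear forms. For fixed `c, x, y`, the form `xᵀ(∑ cᵢ E(i))y`
equals `∑ₜ wₜ ⟨x, η(t)⟩` with `w = Φᵀ(c ⊗ y)`. It is a sum of independent sub-Gaussian terms, with
variance proxy at most `|c|² ‖Φ‖² ‖S‖` for `x, y` in the unit balls (`measure_bilinear_lt_le`).
Half-nets turn norms into maxima of at most `5 ^ (dy + du)` such forms, losing a factor 4. On a
window of length `ℓ`, a grid of `ℓ²` angles suffices: between grid points the transform moves by at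
most a constant times the largest coefficient norm (`hInftyNorm_restrictWindow_le`). Cosines, sines
and single coefficients give at most `3ℓ²` vectors `c` with `|c|² ≤ ℓ`, and the union bound costs
only `log ℓ` under the root. -/

namespace ImpulseResponse

/-! ### Nets and operator norms -/

/-- The closed unit ball of a finite-dimensional real normed space has a `1/2`-net with at most
`5 ^ dim` points. -/
theorem exists_halfNet (E : Type*) [NormedAddCommGroup E] [NormedSpace ℝ E]
    [FiniteDimensional ℝ E] :
    ∃ N : Finset E, N.card ≤ 5 ^ Module.finrank ℝ E ∧ (∀ c ∈ N, ‖c‖ ≤ 1) ∧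
      ∀ x : E, ‖x‖ ≤ 1 → ∃ c ∈ N, ‖x - c‖ ≤ 1 / 2 := by
  classical
  -- A 1-separated subset of the ball of radius 2 of maximal size is a 1-net of that ball; halving
  -- it gives the net. This scale is the one of the `5 ^ dim` packing bound.
  let A : Set ℕ := {k | ∃ s : Finset E, s.card = k ∧ (∀ c ∈ s, ‖c‖ ≤ 2) ∧
    ∀ c ∈ s, ∀ d ∈ s, c ≠ d → 1 ≤ ‖c - d‖}
  have hA : BddAbove A := by
    refine ⟨5 ^ Module.finrank ℝ E, ?_⟩
    rintro _ ⟨s, rfl, h1, h2⟩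
    exact Besicovitch.card_le_of_separated s h1 h2
  obtain ⟨s, hs, h1, h2⟩ : sSup A ∈ A := Nat.sSup_mem ⟨0, ∅, by simp⟩ hA
  refine ⟨s.image fun c => (1 / 2 : ℝ) • c,
    Finset.card_image_le.trans (Besicovitch.card_le_of_separated s h1 h2), ?_, ?_⟩
  · simp only [Finset.forall_mem_image]
    intro c hc
    rw [norm_smul, Real.norm_of_nonneg (by norm_num)]
    linarith [h1 c hc]
  · intro x hx
    have hx2 : ‖(2 : ℝ) • x‖ ≤ 2 := by
      rw [norm_smul, Real.norm_of_nonneg (by norm_num)]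
      linarith
    obtain ⟨c, hc, hxc⟩ : ∃ c ∈ s, ‖(2 : ℝ) • x - c‖ ≤ 1 := by
      by_contra! H
      have hmem : (2 : ℝ) • x ∉ s := fun h => by simpa using (H _ h).trans_le' zero_le_one
      have : s.card + 1 ∈ A := by
        refine ⟨insert ((2 : ℝ) • x) s, Finset.card_insert_of_notMem hmem, ?_, ?_⟩
        · simpa using ⟨hx2, h1⟩
        · intro c hc d hd hcd
          rcases Finset.mem_insert.1 hc with rfl | hc <;>
            rcases Finset.mem_insert.1 hd with rfl | hd
          · exact absurd rfl hcd
          · exact (H d hd).le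
          · rw [norm_sub_rev]
            exact (H c hc).le
          · exact h2 c hc d hd hcd
      have := le_csSup hA this
      omega
    refine ⟨_, Finset.mem_image_of_mem _ hc, ?_⟩
    have : x - (1 / 2 : ℝ) • c = (1 / 2 : ℝ) • ((2 : ℝ) • x - c) := by
      rw [smul_sub, smul_smul]
      norm_num
    rw [this, norm_smul, Real.norm_of_nonneg (by norm_num)]
    linarith

/-- The operator norm is at most twice the maximum over a `1/2`-net. -/
theorem opNorm_le_of_halfNet {E F : Type*} [NormedAddCommGroup E] [NormedSpace ℝ E]
    [NormedAddCommGroup F] [NormedSpace ℝ F] (f : E →L[ℝ] F) (N : Set E)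
    (hN : ∀ x : E, ‖x‖ ≤ 1 → ∃ c ∈ N, ‖x - c‖ ≤ 1 / 2) {B : ℝ} (hB : ∀ c ∈ N, ‖f c‖ ≤ B) :
    ‖f‖ ≤ 2 * B := by
  obtain ⟨c₀, hc₀, -⟩ := hN 0 (by simp)
  have hB0 : 0 ≤ B := (norm_nonneg _).trans (hB c₀ hc₀)
  -- The net error is at most half of the norm being estimated, so it can be absorbed on the left.
  have : ‖f‖ ≤ B + ‖f‖ * (1 / 2) := by
    refine ContinuousLinearMap.opNorm_le_of_unit_norm (by positivity) fun x hx => ?_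
    obtain ⟨c, hc, hxc⟩ := hN x hx.le
    calc ‖f x‖ = ‖f c + f (x - c)‖ := by rw [map_sub]; congr 1; abel
      _ ≤ ‖f c‖ + ‖f (x - c)‖ := norm_add_le _ _
      _ ≤ B + ‖f‖ * (1 / 2) := by
        gcongr
        · exact hB c hc
        · exact f.le_opNorm_of_le hxc
  linarith

/-- The norm of a vector is at most twice the maximum of its inner products with a `1/2`-net. -/
theorem norm_le_of_halfNet {E : Type*} [NormedAddCommGroup E] [InnerProductSpace ℝ E] (v : E)
    (N : Set E) (hN : ∀ x : E, ‖x‖ ≤ 1 → ∃ c ∈ N, ‖x - c‖ ≤ 1 / 2) {B : ℝ}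
    (hB : ∀ c ∈ N, inner ℝ c v ≤ B) : ‖v‖ ≤ 2 * B := by
  have hx : ‖(‖v‖⁻¹ : ℝ) • v‖ ≤ 1 := by
    rw [norm_smul, norm_inv, norm_norm]
    exact inv_mul_le_one
  obtain ⟨c, hc, hxc⟩ := hN _ hx
  have h1 : inner ℝ ((‖v‖⁻¹ : ℝ) • v) v = ‖v‖ := by
    rw [real_inner_smul_left, real_inner_self_eq_norm_sq]
    rcases eq_or_ne ‖v‖ 0 with h | h
    · simp [h]
    · field_simp
  have h2 : inner ℝ ((‖v‖⁻¹ : ℝ) • v - c) v ≤ 1 / 2 * ‖v‖ :=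
    (real_inner_le_norm _ _).trans (by gcongr)
  rw [inner_sub_left, h1] at h2
  linarith [hB c hc]

theorem norm_toLp_mulVec_le {m n 𝕜 : Type*} [RCLike 𝕜] [Fintype m] [Fintype n] [DecidableEq n]
    (A : Matrix m n 𝕜) (x : EuclideanSpace 𝕜 n) :
    ‖WithLp.toLp 2 (A *ᵥ x.ofLp)‖ ≤ ‖A‖ * ‖x‖ :=
  A.l2_opNorm_mulVec x

/-- The norm of a real matrix is at most four times the maximum of its bilinear form over
`1/2`-nets of the unit balls. -/
theorem matrix_norm_le_of_halfNets {m n : Type*} [Fintype m] [Fintype n] [DecidableEq n]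
    (W : Matrix m n ℝ) (N₁ : Set (EuclideanSpace ℝ m)) (N₂ : Set (EuclideanSpace ℝ n))
    (h₁ : ∀ x, ‖x‖ ≤ 1 → ∃ c ∈ N₁, ‖x - c‖ ≤ 1 / 2)
    (h₂ : ∀ x, ‖x‖ ≤ 1 → ∃ c ∈ N₂, ‖x - c‖ ≤ 1 / 2) {B : ℝ}
    (hB : ∀ x ∈ N₁, ∀ y ∈ N₂, x.ofLp ⬝ᵥ W *ᵥ y.ofLp ≤ B) : ‖W‖ ≤ 4 * B := by
  rw [Matrix.l2_opNorm_def]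
  refine (opNorm_le_of_halfNet _ N₂ h₂ (B := 2 * B) fun y hy => ?_).trans (by linarith)
  refine norm_le_of_halfNet _ N₁ h₁ fun x hx => ?_
  refine le_of_eq_of_le ?_ (hB x hx y hy)
  rw [PiLp.inner_apply, dotProduct]
  exact Finset.sum_congr rfl fun i _ => mul_comm _ _

/-- The complexification of a real matrix does not increase the operator norm. -/
theorem norm_map_ofReal_le {m n : Type*} [Fintype m] [Fintype n] [DecidableEq n]
    (W : Matrix m n ℝ) : ‖W.map (fun x : ℝ => (x : ℂ))‖ ≤ ‖W‖ := by
  rw [Matrix.l2_opNorm_def]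
  refine ContinuousLinearMap.opNorm_le_bound _ (norm_nonneg _) fun v => ?_
  let re : EuclideanSpace ℝ n := WithLp.toLp 2 fun i => (v i).re
  let im : EuclideanSpace ℝ n := WithLp.toLp 2 fun i => (v i).im
  have hv : ‖v‖ ^ 2 = ‖re‖ ^ 2 + ‖im‖ ^ 2 := by
    simp only [EuclideanSpace.norm_sq_eq, ← Finset.sum_add_distrib, re, im]
    refine Finset.sum_congr rfl fun i _ => ?_
    rw [← Complex.normSq_eq_norm_sq, Complex.normSq_apply, Real.norm_eq_abs, Real.norm_eq_abs,
      sq_abs, sq_abs]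
    ring
  -- A real matrix acts separately on real and imaginary parts.
  have hW : ‖WithLp.toLp 2 (W.map (fun x : ℝ => (x : ℂ)) *ᵥ v.ofLp)‖ ^ 2 =
      ‖WithLp.toLp 2 (W *ᵥ re.ofLp)‖ ^ 2 + ‖WithLp.toLp 2 (W *ᵥ im.ofLp)‖ ^ 2 := by
    simp only [EuclideanSpace.norm_sq_eq, ← Finset.sum_add_distrib, re, im]
    refine Finset.sum_congr rfl fun i _ => ?_
    rw [← Complex.normSq_eq_norm_sq, Complex.normSq_apply, Real.norm_eq_abs, Real.norm_eq_abs,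
      sq_abs, sq_abs]
    simp [Matrix.mulVec, dotProduct, Complex.re_sum, Complex.im_sum, sq]
  change ‖WithLp.toLp 2 (W.map (fun x : ℝ => (x : ℂ)) *ᵥ v.ofLp)‖ ≤ _
  refine le_of_sq_le_sq ?_ (by positivity)
  rw [hW, mul_pow, hv, mul_add, ← mul_pow, ← mul_pow]
  gcongr <;> exact norm_toLp_mulVec_le W _

/-! ### Gaussian tails of bilinear forms -/

theorem dotProduct_mulVec_le_norm {n : Type*} [Fintype n] [DecidableEq n] (S : Matrix n n ℝ)
    (x : EuclideanSpace ℝ n) : x.ofLp ⬝ᵥ S *ᵥ x.ofLp ≤ ‖S‖ * ‖x‖ ^ 2 := by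
  rw [← Matrix.inner_toEuclideanCLM]
  refine (real_inner_le_norm _ _).trans ?_
  have h : ‖Matrix.toEuclideanCLM (𝕜 := ℝ) S x‖ ≤ ‖S‖ * ‖x‖ := norm_toLp_mulVec_le S x
  nlinarith [norm_nonneg x]

theorem HasSubgaussianMGF.mono {Ω : Type*} [MeasurableSpace Ω] {P : Measure Ω} {X : Ω → ℝ}
    {c d : NNReal} (h : HasSubgaussianMGF X c P) (hcd : c ≤ d) : HasSubgaussianMGF X d P where
  integrable_exp_mul := h.integrable_exp_mul
  mgf_le t := (h.mgf_le t).trans (by gcongr)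

/-- A one-dimensional marginal of a centered Gaussian vector with covariance `S` is sub-Gaussian. -/
theorem hasSubgaussianMGF_inner {Ω : Type*} [MeasurableSpace Ω] {P : Measure Ω}
    {n : Type*} [Fintype n] [DecidableEq n] {S : Matrix n n ℝ} (hS : S.PosSemidef)
    {X : Ω → EuclideanSpace ℝ n} (hX : HasLaw X (multivariateGaussian 0 S) P)
    (x : EuclideanSpace ℝ n) :
    HasSubgaussianMGF (fun ω => inner ℝ x (X ω)) (‖S‖₊ * ‖x‖₊ ^ 2) P := by
  have hmap : (multivariateGaussian 0 S).map (innerSL ℝ x) =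
      gaussianReal 0 (x.ofLp ⬝ᵥ S *ᵥ x.ofLp).toNNReal := by
    rw [IsGaussian.map_eq_gaussianReal, (innerSL ℝ x).integral_comp_id_comm IsGaussian.integrable_id, integral_id_multivariateGaussian, map_zero]
    rw [← covarianceBilin_multivariateGaussian (μ := 0) hS,
      covarianceBilin_self IsGaussian.memLp_two_id]
    rfl
  have hg : HasSubgaussianMGF id (x.ofLp ⬝ᵥ S *ᵥ x.ofLp).toNNReal
      ((multivariateGaussian 0 S).map (innerSL ℝ x)) := by
    rw [hmap]
    exact ⟨fun t => integrable_exp_mul_gaussianReal t, fun t => by simp [mgf_id_gaussianReal]⟩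
  have h1 : HasSubgaussianMGF (innerSL ℝ x) (x.ofLp ⬝ᵥ S *ᵥ x.ofLp).toNNReal (P.map X) := by
    rw [hX.map_eq]
    exact (HasSubgaussianMGF.id_map_iff (by fun_prop)).1 hg
  refine HasSubgaussianMGF.mono (HasSubgaussianMGF.of_map hX.aemeasurable h1) ?_
  rw [Real.toNNReal_le_iff_le_coe]
  exact dotProduct_mulVec_le_norm S x

theorem measure_lt_le_of_hasSubgaussianMGF {Ω : Type*} [MeasurableSpace Ω] {P : Measure Ω}
    [IsProbabilityMeasure P] {X : Ω → ℝ} {σ s : ℝ} (hσ : 0 ≤ σ) (hs : 0 ≤ s)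
    (h : HasSubgaussianMGF X (σ ^ 2).toNNReal P) :
    P {ω | σ * s < X ω} ≤ ENNReal.ofReal (Real.exp (-s ^ 2 / 2)) := by
  -- For `σ = 0` the Chernoff exponent would divide by zero; there `X = 0` almost surely, and the
  -- strict inequality makes the event null.
  rcases hσ.eq_or_lt with rfl | hσ
  · have h0 : X =ᵐ[P] 0 :=
      HasSubgaussianMGF.ae_eq_zero_of_hasSubgaussianMGF_zero (by simpa using h)
    have : P {ω | 0 * s < X ω} = 0 := by
      refine measure_mono_null (fun ω hω => ?_) (ae_iff.1 h0)
      simp only [Set.mem_ofPred_eq, zero_mul] at hω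
      exact hω.ne'
    rw [this]
    exact zero_le
  · have h1 := h.measure_ge_le (ε := σ * s) (by positivity)
    rw [Real.coe_toNNReal _ (by positivity)] at h1
    have h2 : -(σ * s) ^ 2 / (2 * σ ^ 2) = -s ^ 2 / 2 := by field_simp
    rw [h2] at h1
    refine (measure_mono fun ω hω => ?_).trans
      ((ENNReal.le_ofReal_iff_toReal_le (measure_ne_top _ _) (by positivity)).2 h1)
    rw [Set.mem_ofPred_eq] at hω ⊢
    exact hω.le

/-- The tail of a bilinear form evaluated at a linear combination of the blocks `E(i)`. -/
theorem measure_bilinear_lt_le {Ω : Type*} [MeasurableSpace Ω] {P : Measure Ω}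
    [IsProbabilityMeasure P] {L T dy du : ℕ} {S : Matrix (Fin dy) (Fin dy) ℝ} (hS : S.PosSemidef)
    {η : Fin T → Ω → EuclideanSpace ℝ (Fin dy)}
    (hη : ∀ t, HasLaw (η t) (multivariateGaussian 0 S) P) (hind : iIndepFun η P)
    (Φ : Matrix (Fin (L + 1) × Fin du) (Fin T) ℝ) {E : ℕ → Ω → Matrix (Fin dy) (Fin du) ℝ}
    (hE : ∀ᵐ ω ∂P, stackMatrices L (fun t => E t ω) = Φ * stackVectors (fun t => η t ω))
    {m : ℝ} (hm : 0 ≤ m) (c : Fin (L + 1) → ℝ) (hc : ∑ i, c i ^ 2 ≤ m)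
    {x : EuclideanSpace ℝ (Fin dy)} (hx : ‖x‖ ≤ 1) {y : EuclideanSpace ℝ (Fin du)} (hy : ‖y‖ ≤ 1)
    {s : ℝ} (hs : 0 ≤ s) :
    P {ω | √m * √‖S‖ * ‖Φ‖ * s < x.ofLp ⬝ᵥ (∑ i : Fin (L + 1), c i • E i ω) *ᵥ y.ofLp} ≤
      ENNReal.ofReal (Real.exp (-s ^ 2 / 2)) := by
  -- `q = c ⊗ y`, so `‖q‖² = |c|² ‖y‖²`; transposing `Φ` onto it gives the weights of the `⟨x,
  -- η(t)⟩`.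
  let q : EuclideanSpace ℝ (Fin (L + 1) × Fin du) := WithLp.toLp 2 fun p => c p.1 * y p.2
  have hq : ‖q‖ ^ 2 ≤ m := by
    have : ‖q‖ ^ 2 = (∑ i, c i ^ 2) * ‖y‖ ^ 2 := by
      simp only [EuclideanSpace.real_norm_sq_eq, q, Fintype.sum_prod_type, mul_pow,
        Finset.sum_mul_sum]
    rw [this]
    have : ‖y‖ ^ 2 ≤ 1 := pow_le_one₀ (norm_nonneg _) hy
    calc (∑ i, c i ^ 2) * ‖y‖ ^ 2 ≤ m * 1 := by gcongr
      _ = m := mul_one m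
  let w : EuclideanSpace ℝ (Fin T) := WithLp.toLp 2 (Φᴴ *ᵥ q.ofLp)
  have hw : ‖w‖ ≤ ‖Φ‖ * √m := by
    refine (norm_toLp_mulVec_le Φᴴ q).trans ?_
    rw [Matrix.l2_opNorm_conjTranspose]
    gcongr
    exact Real.le_sqrt_of_sq_le hq
  have hsub : HasSubgaussianMGF (fun ω => ∑ t, w t * inner ℝ x (η t ω))
      ((√m * √‖S‖ * ‖Φ‖) ^ 2).toNNReal P := by
    have hi : iIndepFun (fun t ω => w t * inner ℝ x (η t ω)) P :=
      hind.comp (fun t v => w t * inner ℝ x v) (fun t => by fun_prop)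
    refine HasSubgaussianMGF.mono (HasSubgaussianMGF.sum_of_iIndepFun hi (s := Finset.univ)
      fun t _ => (hasSubgaussianMGF_inner hS (hη t) x).const_mul (w t)) ?_
    rw [← NNReal.coe_le_coe, Real.coe_toNNReal _ (by positivity)]
    push_cast
    change ∑ t, w t ^ 2 * (‖S‖ * ‖x‖ ^ 2) ≤ _
    rw [← Finset.sum_mul, ← EuclideanSpace.real_norm_sq_eq]
    have : ‖x‖ ^ 2 ≤ 1 := pow_le_one₀ (norm_nonneg _) hx
    calc ‖w‖ ^ 2 * (‖S‖ * ‖x‖ ^ 2) ≤ (‖Φ‖ * √m) ^ 2 * (‖S‖ * 1) := by gcongr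
      _ = (√m * √‖S‖ * ‖Φ‖) ^ 2 := by
        rw [mul_pow (√m * _), mul_pow √m, Real.sq_sqrt (norm_nonneg S)]
        ring
  refine measure_lt_le_of_hasSubgaussianMGF (by positivity) hs (hsub.congr ?_)
  filter_upwards [hE] with ω hω
  have hentry : ∀ (i : Fin (L + 1)) (k : Fin dy) (j : Fin du),
      E i ω k j = ∑ t, Φ (i, j) t * η t ω k := by
    intro i k j
    have := congrFun (congrFun hω (i, j)) k
    simpa [stackMatrices, stackVectors, Matrix.mul_apply] using this
  have h1 : ∀ t, w t = ∑ i : Fin (L + 1), ∑ j, Φ (i, j) t * (c i * y j) := by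
    intro t
    simp [w, q, Matrix.mulVec, dotProduct, Fintype.sum_prod_type, Matrix.conjTranspose_apply]
  have h2 : ∀ t, inner ℝ x (η t ω) = ∑ k, x k * η t ω k := by
    intro t
    rw [PiLp.inner_apply]
    exact Finset.sum_congr rfl fun i _ => mul_comm _ _
  simp only [h1, h2, dotProduct, Matrix.mulVec, Matrix.sum_apply, Matrix.smul_apply, hentry,
    smul_eq_mul, Finset.sum_mul, Finset.mul_sum]
  rw [Finset.sum_comm]
  refine Finset.sum_congr rfl fun k _ => ?_
  simp_rw [Finset.sum_comm (s := (Finset.univ : Finset (Fin (L + 1))))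
    (t := (Finset.univ : Finset (Fin du)))]
  rw [Finset.sum_comm]
  refine Finset.sum_congr rfl fun j _ => ?_
  rw [Finset.sum_comm]
  exact Finset.sum_congr rfl fun i _ => Finset.sum_congr rfl fun t _ => by ring

/-! ### Discretization of the unit circle -/

theorem exists_angle_grid {N : ℕ} (hN : 0 < N) (z : Circle) :
    ∃ j < N, ∃ θ : ℝ, Circle.exp θ = z ∧ |θ - 2 * Real.pi * j / N| ≤ 2 * Real.pi / N := by
  have hpi := Real.pi_pos
  have hN' : (0 : ℝ) < N := by exact_mod_cast hN
  obtain ⟨θ, hθ, h0, h1⟩ : ∃ θ : ℝ, Circle.exp θ = z ∧ 0 ≤ θ ∧ θ < 2 * Real.pi := by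
    rcases le_or_gt 0 (Complex.arg z) with h | h
    · exact ⟨_, Circle.exp_arg z, h, by linarith [Complex.arg_le_pi z]⟩
    · exact ⟨Complex.arg z + 2 * Real.pi, by rw [Circle.periodic_exp, Circle.exp_arg],
        by linarith [Complex.neg_pi_lt_arg z], by linarith⟩
  have hx : 0 ≤ θ * N / (2 * Real.pi) := by positivity
  have hle := Nat.floor_le hx
  have hlt := Nat.lt_floor_add_one (θ * N / (2 * Real.pi))
  refine ⟨⌊θ * N / (2 * Real.pi)⌋₊, ?_, θ, hθ, ?_⟩
  · rw [Nat.floor_lt hx, div_lt_iff₀ (by positivity)]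
    nlinarith
  · rw [le_div_iff₀ (by positivity)] at hle
    rw [div_lt_iff₀ (by positivity)] at hlt
    have e : θ - 2 * Real.pi * (⌊θ * N / (2 * Real.pi)⌋₊ : ℝ) / N =
        (θ * N - ⌊θ * N / (2 * Real.pi)⌋₊ * (2 * Real.pi)) / N := by
      field_simp
    rw [e, abs_of_nonneg (div_nonneg (by linarith) hN'.le)]
    gcongr
    linarith

theorem norm_exp_mul_I_sub_exp_mul_I_le (x y : ℝ) :
    ‖Complex.exp (x * Complex.I) - Complex.exp (y * Complex.I)‖ ≤ |x - y| := by
  have e : Complex.exp (x * Complex.I) - Complex.exp (y * Complex.I) =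
      Complex.exp (y * Complex.I) * (Complex.exp (Complex.I * (x - y : ℝ)) - 1) := by
    rw [mul_sub, ← Complex.exp_add, mul_one]
    congr 2
    push_cast
    ring
  rw [e, norm_mul, Complex.norm_exp_ofReal_mul_I, one_mul]
  exact Real.norm_exp_I_mul_ofReal_sub_one_le

theorem zTransform_restrictWindow {dy du : ℕ} {a : ℤ} {b ℓ : ℕ} (hb : (b : ℤ) = a + 1)
    (F : ℕ → Matrix (Fin dy) (Fin du) ℝ) (z : Circle) :
    zTransform (restrictWindow a ℓ F) z =
      ∑ n ∈ Finset.Ico b (b + ℓ), ((z : ℂ)⁻¹ ^ n) • (F n).map (fun x : ℝ => (x : ℂ)) := by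
  have hmem : ∀ n : ℕ, (n : ℤ) ∈ Set.Icc (a + 1) (a + ℓ) ↔ n ∈ Finset.Ico b (b + ℓ) := by
    intro n
    rw [Set.mem_Icc, Finset.mem_Ico]
    omega
  rw [zTransform, tsum_eq_sum (s := Finset.Ico b (b + ℓ))]
  · refine Finset.sum_congr rfl fun n hn => ?_
    rw [restrictWindow, Set.indicator_of_mem (by rw [Set.mem_ofPred_eq, hmem]; exact hn)]
  · intro n hn
    rw [restrictWindow, Set.indicator_of_notMem (by rw [Set.mem_ofPred_eq, hmem]; exact hn)]
    ext
    simp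

/-- The `H∞` norm of a window is controlled by the coefficients together with the values of the
real and imaginary parts of the Z-transform on a grid of `ℓ ^ 2` angles. -/
theorem hInftyNorm_restrictWindow_le {dy du : ℕ} {a : ℤ} {b ℓ : ℕ} (hb : (b : ℤ) = a + 1)
    (hℓ : 1 ≤ ℓ) (F : ℕ → Matrix (Fin dy) (Fin du) ℝ) {B : ℝ}
    (hF : ∀ n ∈ Finset.Ico b (b + ℓ), ‖F n‖ ≤ B)
    (hcos : ∀ j < ℓ ^ 2, ‖∑ n ∈ Finset.Ico b (b + ℓ),
      Real.cos (((n : ℝ) - b) * (2 * Real.pi * j / (ℓ ^ 2 : ℕ))) • F n‖ ≤ B)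
    (hsin : ∀ j < ℓ ^ 2, ‖∑ n ∈ Finset.Ico b (b + ℓ),
      Real.sin (((n : ℝ) - b) * (2 * Real.pi * j / (ℓ ^ 2 : ℕ))) • F n‖ ≤ B) :
    hInftyNorm (restrictWindow a ℓ F) ≤ ENNReal.ofReal (9 * B) := by
  refine iSup_le fun z => ENNReal.ofReal_le_ofReal ?_
  have hℓ' : (1 : ℝ) ≤ ℓ := by exact_mod_cast hℓ
  have hB : 0 ≤ B := (norm_nonneg _).trans (hF b (by rw [Finset.mem_Ico]; omega))
  obtain ⟨j, hj, θ, hθ, hd⟩ := exists_angle_grid (N := ℓ ^ 2) (by positivity) z⁻¹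
  set φ : ℝ := 2 * Real.pi * j / (ℓ ^ 2 : ℕ) with hφ
  set I := Finset.Ico b (b + ℓ) with hI
  let G : ℕ → Matrix (Fin dy) (Fin du) ℂ := fun n => (F n).map (fun x : ℝ => (x : ℂ))
  have hz : (z : ℂ)⁻¹ = Complex.exp (θ * Complex.I) := by
    rw [← Circle.coe_exp, hθ, Circle.coe_inv]
  -- Factoring out a unimodular power leaves frequencies `n - b` in `[0, ℓ)`, so the grid size
  -- depends only on the length of the window and not on its position.
  have e1 : zTransform (restrictWindow a ℓ F) z = Complex.exp (θ * Complex.I) ^ b •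
      ∑ n ∈ I, Complex.exp (((n : ℝ) - b) * θ * Complex.I) • G n := by
    rw [zTransform_restrictWindow hb, Finset.smul_sum]
    refine Finset.sum_congr rfl fun n _ => ?_
    rw [smul_smul, hz, ← Complex.exp_nat_mul, ← Complex.exp_nat_mul, ← Complex.exp_add]
    congr 2
    push_cast
    ring
  have e2 : ∑ n ∈ I, Complex.exp (((n : ℝ) - b) * φ * Complex.I) • G n =
      (∑ n ∈ I, Real.cos (((n : ℝ) - b) * φ) • F n).map (fun x : ℝ => (x : ℂ)) +
      Complex.I • (∑ n ∈ I, Real.sin (((n : ℝ) - b) * φ) • F n).map (fun x : ℝ => (x : ℂ)) := by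
    ext k l
    simp only [Matrix.add_apply, Matrix.smul_apply, Matrix.map_apply, Matrix.sum_apply,
      smul_eq_mul, Complex.ofReal_sum, Finset.mul_sum, ← Finset.sum_add_distrib, G]
    refine Finset.sum_congr rfl fun n _ => ?_
    rw [Complex.exp_mul_I]
    push_cast
    ring
  have h2 : ‖∑ n ∈ I, Complex.exp (((n : ℝ) - b) * φ * Complex.I) • G n‖ ≤ 2 * B := by
    rw [e2]
    refine (norm_add_le _ _).trans ?_
    rw [norm_smul, Complex.norm_I, one_mul, two_mul]
    exact add_le_add ((norm_map_ofReal_le _).trans (hcos j hj))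
      ((norm_map_ofReal_le _).trans (hsin j hj))
  -- Each of the `ℓ` phases moves by at most `ℓ · 2π / ℓ²`, and each coefficient has norm at most
  -- `B`.
  have h3 : ‖∑ n ∈ I, (Complex.exp (((n : ℝ) - b) * θ * Complex.I) -
      Complex.exp (((n : ℝ) - b) * φ * Complex.I)) • G n‖ ≤ 2 * Real.pi * B := by
    have : ∀ n ∈ I, ‖(Complex.exp (((n : ℝ) - b) * θ * Complex.I) -
        Complex.exp (((n : ℝ) - b) * φ * Complex.I)) • G n‖ ≤ 2 * Real.pi / ℓ * B := by
      intro n hn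
      rw [norm_smul]
      have hn' := Finset.mem_Ico.1 hn
      have hn1 : (b : ℝ) ≤ n := by exact_mod_cast hn'.1
      have hn2 : (n : ℝ) ≤ b + ℓ := by exact_mod_cast hn'.2.le
      have hexp := norm_exp_mul_I_sub_exp_mul_I_le (((n : ℝ) - b) * θ) (((n : ℝ) - b) * φ)
      push_cast at hexp ⊢
      refine mul_le_mul (hexp.trans ?_) ((norm_map_ofReal_le _).trans (hF n hn)) (norm_nonneg _)
        (by positivity)
      rw [← mul_sub, abs_mul, abs_of_nonneg (sub_nonneg.2 hn1)]
      calc ((n : ℝ) - b) * |θ - φ| ≤ ℓ * (2 * Real.pi / (ℓ ^ 2 : ℕ)) := by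
            gcongr
            linarith
        _ = 2 * Real.pi / ℓ := by
            push_cast
            field_simp
    refine (norm_sum_le_of_le _ this).trans_eq ?_
    rw [Finset.sum_const, hI, Nat.card_Ico, add_tsub_cancel_left, nsmul_eq_mul]
    field_simp
  rw [e1, norm_smul, norm_pow, Complex.norm_exp_ofReal_mul_I, one_pow, one_mul]
  have e3 : ∑ n ∈ I, Complex.exp (((n : ℝ) - b) * θ * Complex.I) • G n =
      ∑ n ∈ I, Complex.exp (((n : ℝ) - b) * φ * Complex.I) • G n +
      ∑ n ∈ I, (Complex.exp (((n : ℝ) - b) * θ * Complex.I) -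
        Complex.exp (((n : ℝ) - b) * φ * Complex.I)) • G n := by
    rw [← Finset.sum_add_distrib]
    exact Finset.sum_congr rfl fun n _ => by rw [← add_smul, add_sub_cancel]
  rw [e3]
  refine (norm_add_le _ _).trans ?_
  -- The constant 9 comes from `2 + 2π < 9`.
  nlinarith [Real.pi_lt_d2]

/-! ### Union bound and choice of the level -/

/-- A union bound over nets and over a finite family of linear combinations of the `E(i)`. -/
theorem measure_exists_norm_lt_le {Ω : Type*} [MeasurableSpace Ω] {P : Measure Ω}
    [IsProbabilityMeasure P] {L T dy du : ℕ} {S : Matrix (Fin dy) (Fin dy) ℝ} (hS : S.PosSemidef)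
    {η : Fin T → Ω → EuclideanSpace ℝ (Fin dy)}
    (hη : ∀ t, HasLaw (η t) (multivariateGaussian 0 S) P) (hind : iIndepFun η P)
    (Φ : Matrix (Fin (L + 1) × Fin du) (Fin T) ℝ) {E : ℕ → Ω → Matrix (Fin dy) (Fin du) ℝ}
    (hE : ∀ᵐ ω ∂P, stackMatrices L (fun t => E t ω) = Φ * stackVectors (fun t => η t ω))
    {m : ℝ} (hm : 0 ≤ m) (K : Finset (Fin (L + 1) → ℝ)) (hK : ∀ c ∈ K, ∑ i, c i ^ 2 ≤ m)
    {s : ℝ} (hs : 0 ≤ s) :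
    P {ω | ∃ c ∈ K, 4 * (√m * √‖S‖ * ‖Φ‖ * s) < ‖∑ i : Fin (L + 1), c i • E i ω‖} ≤
      ENNReal.ofReal (K.card * 5 ^ (dy + du) * Real.exp (-s ^ 2 / 2)) := by
  obtain ⟨N₁, hN₁, hb₁, hc₁⟩ := exists_halfNet (EuclideanSpace ℝ (Fin dy))
  obtain ⟨N₂, hN₂, hb₂, hc₂⟩ := exists_halfNet (EuclideanSpace ℝ (Fin du))
  rw [finrank_euclideanSpace_fin] at hN₁ hN₂
  have hsub : {ω | ∃ c ∈ K, 4 * (√m * √‖S‖ * ‖Φ‖ * s) < ‖∑ i : Fin (L + 1), c i • E i ω‖} ⊆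
      ⋃ p ∈ K ×ˢ N₁ ×ˢ N₂, {ω | √m * √‖S‖ * ‖Φ‖ * s <
        p.2.1.ofLp ⬝ᵥ (∑ i : Fin (L + 1), p.1 i • E i ω) *ᵥ p.2.2.ofLp} := by
    rintro ω ⟨c, hc, hω⟩
    by_contra H
    refine absurd hω (not_lt.2 (matrix_norm_le_of_halfNets _ N₁ N₂ hc₁ hc₂ fun x hx y hy => ?_))
    by_contra! hlt
    refine H (Set.mem_biUnion (x := (c, x, y)) ?_ hlt)
    simpa using ⟨hc, hx, hy⟩
  refine (measure_mono hsub).trans ((measure_biUnion_finset_le _ _).trans ?_)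
  have hcard : ((K ×ˢ N₁ ×ˢ N₂).card : ℝ) ≤ K.card * 5 ^ (dy + du) := by
    rw [Finset.card_product, Finset.card_product, pow_add]
    have h₁ : (N₁.card : ℝ) ≤ 5 ^ dy := by exact_mod_cast hN₁
    have h₂ : (N₂.card : ℝ) ≤ 5 ^ du := by exact_mod_cast hN₂
    push_cast
    gcongr
  calc _ ≤ ∑ _p ∈ K ×ˢ N₁ ×ˢ N₂, ENNReal.ofReal (Real.exp (-s ^ 2 / 2)) := by
        refine Finset.sum_le_sum fun p hp => ?_
        simp only [Finset.mem_product] at hp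
        exact measure_bilinear_lt_le hS hη hind Φ hE hm p.1 (hK _ hp.1) (hb₁ _ hp.2.1)
          (hb₂ _ hp.2.2) hs
    _ = ENNReal.ofReal ((K ×ˢ N₁ ×ˢ N₂).card * Real.exp (-s ^ 2 / 2)) := by
        rw [Finset.sum_const, nsmul_eq_mul, ENNReal.ofReal_mul (by positivity),
          ENNReal.ofReal_natCast]
    _ ≤ _ := by gcongr

/-- The coefficients `g`, restricted to the window of length `ℓ` starting at `b`. -/
def windowCoeff (L b ℓ : ℕ) (g : ℕ → ℝ) : Fin (L + 1) → ℝ :=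
  fun i => if (i : ℕ) ∈ Finset.Ico b (b + ℓ) then g i else 0

/-- A general `f` vanishing at coefficient zero serves both the sum of squares and the matrix
combination. -/
theorem sum_windowCoeff {L b ℓ : ℕ} (h : b + ℓ ≤ L + 1) (g : ℕ → ℝ) {M : Type*} [AddCommMonoid M]
    (f : ℝ → ℕ → M) (hf : ∀ n, f 0 n = 0) :
    ∑ i : Fin (L + 1), f (windowCoeff L b ℓ g i) i = ∑ n ∈ Finset.Ico b (b + ℓ), f (g n) n := by
  have : ∀ i : Fin (L + 1), f (windowCoeff L b ℓ g i) i =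
      (fun n : ℕ => if n ∈ Finset.Ico b (b + ℓ) then f (g n) n else 0) i := by
    intro i
    simp only [windowCoeff]
    split_ifs <;> simp [hf]
  rw [Fintype.sum_congr _ _ this, Fin.sum_univ_eq_sum_range
    (fun n : ℕ => if n ∈ Finset.Ico b (b + ℓ) then f (g n) n else 0), Finset.sum_ite_mem]
  congr 1
  rw [Finset.inter_eq_right]
  intro n hn
  rw [Finset.mem_Ico] at hn
  rw [Finset.mem_range]
  omega

theorem sum_windowCoeff_sq_le {L b ℓ : ℕ} (h : b + ℓ ≤ L + 1) {g : ℕ → ℝ} (hg : ∀ n, |g n| ≤ 1) :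
    ∑ i, windowCoeff L b ℓ g i ^ 2 ≤ ℓ := by
  rw [sum_windowCoeff h g (fun x _ => x ^ 2) (by simp)]
  refine (Finset.sum_le_card_nsmul _ _ 1 fun n _ => ?_).trans_eq ?_
  · exact (sq_le_one_iff_abs_le_one _).2 (hg n)
  · simp

/-- A finite family of coefficients that suffices to control the `H∞` norm on a window. -/
theorem exists_windowCoeff_family {L b ℓ : ℕ} {a : ℤ} (hb : (b : ℤ) = a + 1)
    (h : b + ℓ ≤ L + 1) (hℓ : 1 ≤ ℓ) :
    ∃ K : Finset (Fin (L + 1) → ℝ), K.card ≤ 3 * ℓ ^ 2 ∧ (∀ c ∈ K, ∑ i, c i ^ 2 ≤ (ℓ : ℝ)) ∧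
      -- `K` is chosen before `F`, hence is deterministic when `F` is random.
      ∀ {dy du : ℕ} (F : ℕ → Matrix (Fin dy) (Fin du) ℝ) (B : ℝ),
        (∀ c ∈ K, ‖∑ i : Fin (L + 1), c i • F i‖ ≤ B) →
          hInftyNorm (restrictWindow a ℓ F) ≤ ENNReal.ofReal (9 * B) := by
  classical
  let u : ℕ → Fin (L + 1) → ℝ := fun j => windowCoeff L b ℓ
    fun n => Real.cos (((n : ℝ) - b) * (2 * Real.pi * j / (ℓ ^ 2 : ℕ)))
  let v : ℕ → Fin (L + 1) → ℝ := fun j => windowCoeff L b ℓ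
    fun n => Real.sin (((n : ℝ) - b) * (2 * Real.pi * j / (ℓ ^ 2 : ℕ)))
  let w : ℕ → Fin (L + 1) → ℝ := fun k => windowCoeff L b ℓ fun n => if n = k then 1 else 0
  refine ⟨((Finset.range (ℓ ^ 2)).image u ∪ (Finset.range (ℓ ^ 2)).image v) ∪
    (Finset.Ico b (b + ℓ)).image w, ?_, ?_, ?_⟩
  · have h1 : ((Finset.range (ℓ ^ 2)).image u).card ≤ ℓ ^ 2 :=
      Finset.card_image_le.trans_eq (by simp)
    have h2 : ((Finset.range (ℓ ^ 2)).image v).card ≤ ℓ ^ 2 :=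
      Finset.card_image_le.trans_eq (by simp)
    have h3 : ((Finset.Ico b (b + ℓ)).image w).card ≤ ℓ := Finset.card_image_le.trans_eq (by simp)
    have h4 : ℓ ≤ ℓ ^ 2 := Nat.le_self_pow two_ne_zero ℓ
    refine (Finset.card_union_le _ _).trans ?_
    have := Finset.card_union_le ((Finset.range (ℓ ^ 2)).image u) ((Finset.range (ℓ ^ 2)).image v)
    omega
  · intro c hc
    simp only [Finset.mem_union, Finset.mem_image] at hc
    rcases hc with (⟨j, -, rfl⟩ | ⟨j, -, rfl⟩) | ⟨k, -, rfl⟩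
    · exact sum_windowCoeff_sq_le h fun n => Real.abs_cos_le_one _
    · exact sum_windowCoeff_sq_le h fun n => Real.abs_sin_le_one _
    · refine sum_windowCoeff_sq_le h fun n => ?_
      split_ifs <;> simp
  · intro dy du F B hB
    have key : ∀ g : ℕ → ℝ, ∑ i : Fin (L + 1), windowCoeff L b ℓ g i • F i =
        ∑ n ∈ Finset.Ico b (b + ℓ), g n • F n :=
      fun g => sum_windowCoeff h g (fun x n => x • F n) (by simp)
    refine hInftyNorm_restrictWindow_le hb hℓ F (fun n hn => ?_) (fun j hj => ?_) fun j hj => ?_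
    · have := hB (w n) (Finset.mem_union_right _ (Finset.mem_image_of_mem _ hn))
      rw [key] at this
      simpa only [ite_smul, one_smul, zero_smul, Finset.sum_ite_eq', if_pos hn] using this
    · rw [← key]
      exact hB (u j) (Finset.mem_union_left _ (Finset.mem_union_left _
        (Finset.mem_image_of_mem _ (Finset.mem_range.2 hj))))
    · rw [← key]
      exact hB (v j) (Finset.mem_union_left _ (Finset.mem_union_right _
        (Finset.mem_image_of_mem _ (Finset.mem_range.2 hj))))

theorem log_five_le_two : Real.log 5 ≤ 2 := by
  rw [Real.log_le_iff_le_exp (by norm_num)]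
  have h := Real.exp_one_gt_d9
  have : Real.exp 2 = Real.exp 1 * Real.exp 1 := by
    rw [← Real.exp_add]
    norm_num
  nlinarith

/-- The deviation level is large enough for the union bound. -/
theorem card_mul_exp_le {k ℓ d : ℕ} (hk : k ≤ 3 * ℓ ^ 2) (hℓ : 1 ≤ ℓ) {δ : ℝ} (hδ : 0 < δ)
    (hδ' : δ ≤ 1 / 2) {s : ℝ} (hs : s ^ 2 = 9 * (d + Real.log (ℓ / δ))) :
    k * 5 ^ d * Real.exp (-s ^ 2 / 2) ≤ δ := by
  have hℓ' : (1 : ℝ) ≤ ℓ := by exact_mod_cast hℓ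
  have hk' : (k : ℝ) ≤ 3 * ℓ ^ 2 := by exact_mod_cast hk
  have hx : 0 < ℓ / δ := by positivity
  have hx2 : 2 ≤ ℓ / δ := by
    rw [le_div_iff₀ hδ]
    linarith
  set x := ℓ / δ with hxdef
  have h5 : (5 : ℝ) ^ d ≤ Real.exp (2 * d) := by
    rw [← Real.exp_log (show (0 : ℝ) < 5 by norm_num), ← Real.exp_nat_mul]
    refine Real.exp_le_exp.2 ?_
    nlinarith [log_five_le_two, Nat.cast_nonneg (α := ℝ) d]
  -- Since `x ≥ 2` and `ℓ = δx ≤ x`, one has `3ℓ² ≤ x²ℓ² ≤ ℓx³ = δx⁴`.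
  have hk2 : (k : ℝ) ≤ δ * Real.exp (4 * Real.log x) := by
    have : Real.exp (4 * Real.log x) = x ^ 4 := by
      rw [show (4 : ℝ) = (4 : ℕ) by norm_num, Real.exp_nat_mul, Real.exp_log hx]
    have hδx : δ * x = ℓ := by
      rw [hxdef]
      field_simp
    have hℓx : ℓ ≤ x := by
      rw [hxdef, le_div_iff₀ hδ]
      nlinarith
    rw [this]
    calc (k : ℝ) ≤ 3 * ℓ ^ 2 := hk'
      _ ≤ x ^ 2 * ℓ ^ 2 := by
        gcongr
        nlinarith
      _ = ℓ * (ℓ * x ^ 2) := by ring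
      _ ≤ ℓ * (x * x ^ 2) := by gcongr
      _ = δ * x ^ 4 := by rw [← hδx]; ring
  have hlog : 0 ≤ Real.log x := Real.log_nonneg (by linarith)
  calc (k : ℝ) * 5 ^ d * Real.exp (-s ^ 2 / 2)
      ≤ δ * Real.exp (4 * Real.log x) * Real.exp (2 * d) * Real.exp (-s ^ 2 / 2) := by gcongr
    _ = δ * Real.exp (4 * Real.log x + 2 * d + -s ^ 2 / 2) := by
      rw [Real.exp_add, Real.exp_add]
      ring
    _ ≤ δ * 1 := by
      gcongr
      rw [Real.exp_le_one_iff, neg_div, hs]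
      -- The factor 9 in `s²` gives `9/2`, which beats both 4 (on `log x`) and 2 (on `d`).
      nlinarith [Nat.cast_nonneg (α := ℝ) d]
    _ = δ := mul_one δ

end ImpulseResponse

theorem mainTheorem5 :
    ∃ C : ℝ, 0 < C ∧
      ∀ {Ω : Type*} [MeasurableSpace Ω] (P : Measure Ω) [IsProbabilityMeasure P]
        (L L' T dy du : ℕ)
        (S : Matrix (Fin dy) (Fin dy) ℝ) (_ : S.PosSemidef)
        (η : Fin T → Ω → EuclideanSpace ℝ (Fin dy))
        (_ : ∀ t, HasLaw (η t) (multivariateGaussian 0 S) P)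
        (_ : iIndepFun η P)
        (Φ : Matrix (Fin (L + 1) × Fin du) (Fin T) ℝ)
        (E : ℕ → Ω → Matrix (Fin dy) (Fin du) ℝ)
        (_ : ∀ᵐ ω ∂P, ImpulseResponse.stackMatrices L (fun t => E t ω) =
          Φ * ImpulseResponse.stackVectors (fun t => η t ω))
        (δ : ℝ) (_ : 0 < δ) (_ : δ ≤ 1 / 2)
        (a : ℤ) (_ : 1 ≤ L') (_ : -1 ≤ a) (_ : a + (L' : ℤ) ≤ (L : ℤ)),
        ENNReal.ofReal (1 - δ) ≤
          P {ω | ImpulseResponse.hInftyNorm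
                (ImpulseResponse.restrictWindow a L' (fun t => E t ω)) ≤
              ENNReal.ofReal (C * √(L' : ℝ) * √‖S‖ * ‖Φ‖ *
                √((dy : ℝ) + (du : ℝ) + Real.log ((L' : ℝ) / δ)))} := by
  -- `108 = 9 · 4 · 3`: angle grid, nets, and deviation level `s = 3√D`.
  refine ⟨108, by norm_num, ?_⟩
  intro Ω _ P _ L L' T dy du S hS η hη hind Φ E hE δ hδ hδ' a hL' ha haL
  obtain ⟨b, hb⟩ : ∃ b : ℕ, (b : ℤ) = a + 1 := ⟨(a + 1).toNat, Int.toNat_of_nonneg (by omega)⟩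
  obtain ⟨K, hKcard, hKsq, hK⟩ :=
    ImpulseResponse.exists_windowCoeff_family (L := L) hb (by omega) hL'
  set D : ℝ := (dy : ℝ) + (du : ℝ) + Real.log ((L' : ℝ) / δ) with hD
  have hL'' : (1 : ℝ) ≤ L' := by exact_mod_cast hL'
  have hlog : 0 ≤ Real.log ((L' : ℝ) / δ) := by
    refine Real.log_nonneg ?_
    rw [le_div_iff₀ hδ]
    linarith
  have hD0 : 0 ≤ D := by positivity
  have hs : (3 * √D) ^ 2 = 9 * (((dy + du : ℕ) : ℝ) + Real.log ((L' : ℝ) / δ)) := by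
    rw [mul_pow, Real.sq_sqrt hD0, hD]
    push_cast
    ring
  have hbad := (ImpulseResponse.measure_exists_norm_lt_le hS hη hind Φ hE
    (Nat.cast_nonneg L') K hKsq (s := 3 * √D) (by positivity)).trans
    (ENNReal.ofReal_le_ofReal (ImpulseResponse.card_mul_exp_le hKcard hL' hδ hδ' hs))
  set bad : Set Ω := {ω | ∃ c ∈ K, 4 * (√(L' : ℝ) * √‖S‖ * ‖Φ‖ * (3 * √D)) <
    ‖∑ i : Fin (L + 1), c i • E i ω‖}
  have hgood : badᶜ ⊆ {ω | ImpulseResponse.hInftyNorm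
      (ImpulseResponse.restrictWindow a L' (fun t => E t ω)) ≤
        ENNReal.ofReal (108 * √(L' : ℝ) * √‖S‖ * ‖Φ‖ * √D)} := by
    intro ω hω
    have h : ∀ c ∈ K, ‖∑ i : Fin (L + 1), c i • E i ω‖ ≤
        4 * (√(L' : ℝ) * √‖S‖ * ‖Φ‖ * (3 * √D)) := by
      intro c hc
      by_contra! hlt
      exact hω ⟨c, hc, hlt⟩
    refine (hK (fun t => E t ω) _ h).trans_eq ?_
    congr 1
    ring
  refine le_trans ?_ (measure_mono hgood)
  -- Subadditivity on `bad ∪ badᶜ` avoids measurability of `bad`: `E` is prescribed only almost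
  -- everywhere.
  rw [ENNReal.ofReal_sub _ hδ.le, ENNReal.ofReal_one, tsub_le_iff_left]
  calc (1 : ℝ≥0∞) = P (bad ∪ badᶜ) := by rw [Set.union_compl_self, measure_univ]
    _ ≤ P bad + P badᶜ := measure_union_le _ _
    _ ≤ ENNReal.ofReal δ + P badᶜ := by gcongr
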